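/- Let $\delta_0,\rho_0\in(0,1)$ and put $$\alpha_0=\frac{(1-\rho_0)(1-\delta_0)^2}{\rho_0},\qquad \beta_0=\frac{(1-\rho_0)(1-\delta_0)}{\rho_0}.$$ There is a constant $C>0$ depending only on $(\delta_0,\rho_0)$ such that for every integer $n\ge 2$ and every centered Gaussian vector $X=(X_1,\dots,X_n)$ (possibly with singular covariance matrix) with $\operatorname{var}(X_i)=1$ for all $i$, whose correlation matrix $R$ satisfies $\max_{i\neq j}R_{ij}\le\rho_0$, $$\mathbb{P}\Big(\max_{1\le i\le n}X_i\le \delta_0\sqrt{2(1-\rho_0)\log n}\Big)\le C\,n^{-\alpha_0}(\log n)^{\frac{\beta_0-1}{2}}.$$ Moreover, this bound is sharp in the following sense: there is a constant $c>0$ depending only on $(\delta_0,\rho_0)$ such that for every integer $n\ge 2$ and every such vector $X$ with $R_{ij}=\rho_0$ for all $i\neq j$, $$\mathbb{P}\Big(\max_{1\le i\le n}X_i\le \delta_0\sqrt{2(1-\rho_0)\log n}\Big)\ge c\,n^{-\alpha_0}(\log n)^{\frac{\beta_0-1}{2}}.$$ -/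

import Mathlib

open MeasureTheory ProbabilityTheory

universe u

/-- The correlation matrix of a finite family of real random variables `X i` under `P`, with
entries `cov(X i, X j) / (sd(X i) * sd(X j))`. -/
noncomputable def correlationMatrix {Ω ι : Type*} [MeasurableSpace Ω]
    (X : ι → Ω → ℝ) (P : Measure Ω) : Matrix ι ι ℝ :=
  Matrix.of fun i j => cov[X i, X j; P] / (√(Var[X i; P]) * √(Var[X j; P]))

/-- `X` is a centered Gaussian vector (possibly with singular covariance) with unit variances:
the `X i` are jointly Gaussian under `P`, with mean `0` and variance `1`. -/
structure IsStandardizedGaussianVector {Ω ι : Type*} [MeasurableSpace Ω]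
    (X : ι → Ω → ℝ) (P : Measure Ω) : Prop where
  hasGaussianLaw : HasGaussianLaw (fun ω i => X i ω) P
  mean_eq_zero : ∀ i, ∫ ω, X i ω ∂P = 0
  variance_eq_one : ∀ i, Var[X i; P] = 1

/-! Slepian's inequality (`slepian_measure`) reduces both bounds to the equicorrelated vector:
larger correlations make a small maximum more likely. That vector is `√(1 - ρ) (G i - W)` with `G i`
independent standard normal and `W` an independent normal variable of variance `κ = ρ / (1 - ρ)`.
Conditioning on `W` turns the probability into the one-dimensional integral `E[Φ(δ L + W) ^ n]`,
where `L = √(2 log n)` and `Φ` is the standard normal distribution function.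

The power `Φ(u) ^ n` jumps from near `0` to near `1` in a window of width of order `1 / L` around `u
= L - log (log n) / (2 L)`. Substituting `u = L + (v - log (log n) / 2) / L` in the Gaussian density
(`integral_gaussianReal_eq_rescaled`) extracts `n ^ (-α)` from the main term of the square, `(log n)
^ (β / 2)` and `exp (-β v)` from the cross term, and `(log n) ^ (-1 / 2)` from `du = dv / L`. The
remaining integral in `v` is bounded above since `Φ ^ n` decays doubly exponentially as `v` becomes
negative (`exists_pow_cdf_le`), and below since `Φ ^ n ≥ 1 / 2` for `v ≥ 0` (`half_le_pow_cdf`).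

Slepian's inequality itself comes from rotating one Gaussian vector into the other. The sign of the
derivative follows from linear regression, without densities, so singular covariances need no
separate treatment. -/

/-! ### Slepian's inequality by Gaussian interpolation -/

/-- If `(W, Z)` is jointly Gaussian with `W` centered and nonnegatively correlated with every
coordinate of `Z`, and `φ` increases along the directions in which `Z` is correlated with `W`,
then `W` and `φ(Z)` are nonnegatively correlated. -/
theorem HasGaussianLaw.integral_mul_comp_nonneg {Ω ι : Type*} [Fintype ι] [MeasurableSpace Ω]
    {P : Measure Ω} {W : Ω → ℝ} {Z : Ω → ι → ℝ} (hWm : Measurable W) (hZm : Measurable Z)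
    (hG : HasGaussianLaw (fun ω => (W ω, Z ω)) P) (hW : ∫ ω, W ω ∂P = 0)
    (hcov : ∀ j, 0 ≤ cov[W, fun ω => Z ω j; P])
    {φ : (ι → ℝ) → ℝ} (hφm : Measurable φ) {M : ℝ} (hφb : ∀ z, |φ z| ≤ M)
    (hφ : ∀ a : ι → ℝ, (∀ j, 0 ≤ a j) → (∀ j, cov[W, fun ω => Z ω j; P] = 0 → a j = 0) →
      ∀ z, φ z ≤ φ (z + a)) :
    0 ≤ ∫ ω, W ω * φ (Z ω) ∂P := by
  have hP := hG.isProbabilityMeasure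
  have hWL := hG.fst.memLp_two
  have hWi := hG.fst.integrable
  have hZL : ∀ j, MemLp (fun ω => Z ω j) 2 P := fun j =>
    (HasGaussianLaw.eval (X := fun j ω => Z ω j) hG.snd j).memLp_two
  -- A degenerate `W` vanishes almost surely; it is set aside because the regression divides by its
  -- variance.
  by_cases hV : Var[W; P] = 0
  · have h0 := ae_eq_integral_of_variance_eq_zero hWL hV
    refine integral_nonneg_of_ae ?_
    filter_upwards [h0] with ω hω
    simp [hω, hW]
  have hVpos : 0 < Var[W; P] := lt_of_le_of_ne (variance_nonneg _ _) (Ne.symm hV)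
  -- Regression coefficients of `Z` on `W`: the residual `R = Z - W a` is uncorrelated with `W`,
  -- hence independent of it by joint Gaussianity.
  set a : ι → ℝ := fun j => cov[W, fun ω => Z ω j; P] / Var[W; P] with ha
  have ha0 : ∀ j, 0 ≤ a j := fun j => div_nonneg (hcov j) hVpos.le
  set R : Ω → ι → ℝ := fun ω => Z ω - W ω • a with hR
  have hRm : Measurable R := hZm.sub (hWm.smul_const a)
  have hGR : HasGaussianLaw (fun ω => ((fun _ : Unit => W ω), R ω)) P := by
    let T : (ℝ × (ι → ℝ)) →L[ℝ] ((Unit → ℝ) × (ι → ℝ)) :=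
      (ContinuousLinearMap.pi fun _ => ContinuousLinearMap.fst ℝ ℝ (ι → ℝ)).prod
        (ContinuousLinearMap.snd ℝ ℝ (ι → ℝ) -
          (ContinuousLinearMap.fst ℝ ℝ (ι → ℝ)).smulRight a)
    exact hG.map_fun T
  have hind : IndepFun W R P := by
    have := HasGaussianLaw.indepFun_of_covariance_eval (X := fun _ : Unit => W)
      (Y := fun j ω => R ω j) hGR (by
        intro _ j
        have : (fun ω => R ω j) = fun ω => Z ω j - W ω * a j := by
          ext ω; simp [hR]
        rw [this, covariance_fun_sub_right hWL (hZL j) (hWL.mul_const _),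
          covariance_mul_const_right, covariance_self hWm.aemeasurable]
        simp only [ha]
        field_simp
        ring)
    exact this.comp (φ := fun f : Unit → ℝ => f ()) (ψ := id) (by fun_prop) measurable_id
  have hφWi : Integrable (fun ω => W ω * φ (Z ω)) P :=
    hWi.mul_bdd (c := M) (hφm.comp hZm).aestronglyMeasurable (ae_of_all _ fun ω => hφb _)
  have hφRi : Integrable (fun ω => W ω * φ (R ω)) P :=
    hWi.mul_bdd (c := M) (hφm.comp hRm).aestronglyMeasurable (ae_of_all _ fun ω => hφb _)
  have h0 : ∫ ω, W ω * φ (R ω) ∂P = 0 := by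
    have := (hind.comp (φ := id) measurable_id hφm).integral_mul_eq_mul_integral
      hWm.aestronglyMeasurable (hφm.comp hRm).aestronglyMeasurable
    have h2 : ∫ ω, W ω * φ (R ω) ∂P = (∫ ω, W ω ∂P) * ∫ ω, φ (R ω) ∂P := this
    rw [h2, hW, zero_mul]
  -- Since `E[W φ(R)] = 0`, it suffices that `W φ(R) ≤ W φ(Z)` pointwise. Moving from `R` to `Z`
  -- adds `W a`, so `φ` changes with the sign of `W`.
  rw [← h0]
  refine integral_mono hφRi hφWi fun ω => ?_
  change W ω * φ (R ω) ≤ W ω * φ (Z ω)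
  have hac : ∀ j, cov[W, fun ω => Z ω j; P] = 0 → a j = 0 := fun j hj => by simp [ha, hj]
  rcases le_total 0 (W ω) with hw | hw
  · refine mul_le_mul_of_nonneg_left ?_ hw
    have := hφ (W ω • a) (fun j => mul_nonneg hw (ha0 j)) (fun j hj => by simp [hac j hj]) (R ω)
    simpa [hR] using this
  · refine mul_le_mul_of_nonpos_left ?_ hw
    have := hφ (-W ω • a) (fun j => mul_nonneg (neg_nonneg.2 hw) (ha0 j))
      (fun j hj => by simp [hac j hj]) (Z ω)
    have e : Z ω + -W ω • a = R ω := by simp [hR, sub_eq_add_neg]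
    rwa [e] at this

/-- Monotonicity of the expectation of a product of decreasing functions in the covariances of a
centered Gaussian vector, for differentiable factors. -/
theorem integral_prod_le_of_covariance_le {ι : Type*} [Fintype ι]
    (μ ν : Measure (ι → ℝ)) [IsGaussian μ] [IsGaussian ν]
    (hμ : ∀ i, ∫ x, x i ∂μ = 0) (hν : ∀ i, ∫ x, x i ∂ν = 0)
    (hdiag : ∀ i, cov[fun x => x i, fun x => x i; μ] = cov[fun x => x i, fun x => x i; ν])
    (hoff : ∀ i j, i ≠ j → cov[fun x => x i, fun x => x j; μ] ≤ cov[fun x => x i, fun x => x j; ν])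
    {g g' : ℝ → ℝ} (hg : ∀ x, HasDerivAt g (g' x) x) (hg' : Continuous g') {M : ℝ}
    (hM : ∀ x, |g' x| ≤ M) (hanti : Antitone g) (h0 : ∀ x, 0 ≤ g x) (h1 : ∀ x, g x ≤ 1) :
    ∫ x, ∏ i, g (x i) ∂μ ≤ ∫ x, ∏ i, g (x i) ∂ν := by
  classical
  have hgc : Continuous g := continuous_iff_continuousAt.2 fun x => (hg x).continuousAt
  have hg'0 : ∀ x, g' x ≤ 0 := fun x => (hg x).deriv ▸ hanti.deriv_nonpos
  have hM0 : 0 ≤ M := (abs_nonneg _).trans (hM 0)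
  set P := μ.prod ν with hP
  -- `Z θ` rotates an independent pair with laws `μ` and `ν` from the first to the second; `W θ` is
  -- its derivative in `θ`.
  set Z : ℝ → (ι → ℝ) × (ι → ℝ) → ι → ℝ :=
    fun θ p j => Real.cos θ * p.1 j + Real.sin θ * p.2 j with hZ
  set W : ℝ → ι → (ι → ℝ) × (ι → ℝ) → ℝ :=
    fun θ i p => -Real.sin θ * p.1 i + Real.cos θ * p.2 i with hW
  have hid : HasGaussianLaw (id : (ι → ℝ) × (ι → ℝ) → _) P := IsGaussian.hasGaussianLaw_id
  have hx : ∀ i, MemLp (fun x : ι → ℝ => x i) 2 μ := fun i =>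
    (HasGaussianLaw.eval (X := fun i (x : ι → ℝ) => x i) IsGaussian.hasGaussianLaw_id i).memLp_two
  have hy : ∀ i, MemLp (fun x : ι → ℝ => x i) 2 ν := fun i =>
    (HasGaussianLaw.eval (X := fun i (x : ι → ℝ) => x i) IsGaussian.hasGaussianLaw_id i).memLp_two
  have hpx : ∀ i, MemLp (fun p : (ι → ℝ) × (ι → ℝ) => p.1 i) 2 P := fun i => (hx i).comp_fst ν
  have hpy : ∀ i, MemLp (fun p : (ι → ℝ) × (ι → ℝ) => p.2 i) 2 P := fun i => (hy i).comp_snd μ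
  have hcov : ∀ θ i j, cov[W θ i, fun p => Z θ p j; P] = Real.sin θ * Real.cos θ *
      (cov[fun x => x i, fun x => x j; ν] - cov[fun x => x i, fun x => x j; μ]) := by
    intro θ i j
    have e1 : cov[fun p : (ι → ℝ) × (ι → ℝ) => p.1 i, fun p => p.1 j; P]
        = cov[fun x => x i, fun x => x j; μ] := by
      have h := covariance_map_fun (μ := P) (Z := Prod.fst) (X := fun x : ι → ℝ => x i)
        (Y := fun x => x j) (measurable_pi_apply i).aestronglyMeasurable
        (measurable_pi_apply j).aestronglyMeasurable (by fun_prop)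
      rw [← h, hP, Measure.map_fst_prod]; simp
    have e2 : cov[fun p : (ι → ℝ) × (ι → ℝ) => p.2 i, fun p => p.2 j; P]
        = cov[fun x => x i, fun x => x j; ν] := by
      have h := covariance_map_fun (μ := P) (Z := Prod.snd) (X := fun x : ι → ℝ => x i)
        (Y := fun x => x j) (measurable_pi_apply i).aestronglyMeasurable
        (measurable_pi_apply j).aestronglyMeasurable (by fun_prop)
      rw [← h, hP, Measure.map_snd_prod]; simp
    have e3 : ∀ i j, cov[fun p : (ι → ℝ) × (ι → ℝ) => p.1 i, fun p => p.2 j; P] = 0 :=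
      fun i j => covariance_fst_snd_prod (hx i) (hy j)
    have e4 : ∀ i j, cov[fun p : (ι → ℝ) × (ι → ℝ) => p.2 i, fun p => p.1 j; P] = 0 :=
      fun i j => by rw [covariance_comm]; exact e3 j i
    have hadd1 := covariance_add_left ((hpx i).const_mul (-Real.sin θ))
      ((hpy i).const_mul (Real.cos θ))
      (((hpx j).const_mul (Real.cos θ)).add ((hpy j).const_mul (Real.sin θ)))
    have : cov[W θ i, fun p => Z θ p j; P] = _ := hadd1
    rw [this, covariance_add_right ((hpx i).const_mul _) ((hpx j).const_mul _)
      ((hpy j).const_mul _), covariance_add_right ((hpy i).const_mul _) ((hpx j).const_mul _)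
      ((hpy j).const_mul _)]
    simp only [covariance_const_mul_left, covariance_const_mul_right, e1, e2, e3, e4]
    ring
  have hZc : ∀ θ, Continuous (Z θ) := fun θ => by fun_prop
  set F' : ℝ → (ι → ℝ) × (ι → ℝ) → ℝ :=
    fun θ p => ∑ i, (∏ j ∈ Finset.univ.erase i, g (Z θ p j)) • (g' (Z θ p i) * W θ i p) with hF'
  have hder : ∀ θ, HasDerivAt (fun θ => ∫ p, ∏ i, g (Z θ p i) ∂P) (∫ p, F' θ p ∂P) θ := by
    intro θ
    refine (hasDerivAt_integral_of_dominated_loc_of_deriv_le (s := Set.univ)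
      (F := fun θ p => ∏ i, g (Z θ p i)) (F' := F')
      (bound := fun p => ∑ i, M * (|p.1 i| + |p.2 i|)) Filter.univ_mem ?_ ?_ ?_ ?_ ?_ ?_).2
    · refine Filter.Eventually.of_forall fun θ => Continuous.aestronglyMeasurable ?_
      fun_prop
    · refine Integrable.of_bound (C := 1) (Continuous.aestronglyMeasurable ?_)
        (ae_of_all _ fun p => ?_)
      · fun_prop
      · rw [Real.norm_eq_abs, abs_of_nonneg (Finset.prod_nonneg fun _ _ => h0 _)]
        exact Finset.prod_le_one (fun _ _ => h0 _) fun _ _ => h1 _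
    · refine Continuous.aestronglyMeasurable ?_
      simp only [hF', hW, smul_eq_mul]
      fun_prop
    · refine ae_of_all _ fun p θ _ => ?_
      rw [Real.norm_eq_abs]
      refine (Finset.abs_sum_le_sum_abs _ _).trans (Finset.sum_le_sum fun i _ => ?_)
      rw [smul_eq_mul, abs_mul, abs_mul]
      have a1 : |∏ j ∈ Finset.univ.erase i, g (Z θ p j)| ≤ 1 := by
        rw [abs_of_nonneg (Finset.prod_nonneg fun _ _ => h0 _)]
        exact Finset.prod_le_one (fun _ _ => h0 _) fun _ _ => h1 _
      have a2 : |W θ i p| ≤ |p.1 i| + |p.2 i| := by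
        refine (abs_add_le _ _).trans (add_le_add ?_ ?_)
        · rw [abs_mul, abs_neg]
          exact mul_le_of_le_one_left (abs_nonneg _) (Real.abs_sin_le_one θ)
        · rw [abs_mul]
          exact mul_le_of_le_one_left (abs_nonneg _) (Real.abs_cos_le_one θ)
      calc _ ≤ 1 * (M * (|p.1 i| + |p.2 i|)) := by
            gcongr
            exact hM _
        _ = _ := one_mul _
    · refine integrable_finsetSum _ fun i _ => Integrable.const_mul ?_ _
      exact ((hpx i).integrable one_le_two).abs.add ((hpy i).integrable one_le_two).abs
    · refine ae_of_all _ fun p θ _ => ?_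
      refine HasDerivAt.fun_finsetProd fun i _ => ?_
      have : HasDerivAt (fun θ => Z θ p i) (W θ i p) θ :=
        ((Real.hasDerivAt_cos θ).mul_const _).add ((Real.hasDerivAt_sin θ).mul_const _)
      exact (hg _).comp θ this
  have hnn : ∀ θ ∈ Set.Icc 0 (Real.pi / 2), 0 ≤ ∫ p, F' θ p ∂P := by
    intro θ hθ
    have hs : 0 ≤ Real.sin θ :=
      Real.sin_nonneg_of_nonneg_of_le_pi hθ.1 (by linarith [hθ.2, Real.pi_pos])
    have hc : 0 ≤ Real.cos θ := Real.cos_nonneg_of_mem_Icc ⟨by linarith [hθ.1, Real.pi_pos], hθ.2⟩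
    have hWint : ∀ i, Integrable (W θ i) P := fun i =>
      (((hpx i).integrable one_le_two).const_mul _).add
        (((hpy i).integrable one_le_two).const_mul _)
    have key : ∀ i, ∀ z : ι → ℝ,
        |(∏ j ∈ Finset.univ.erase i, g (z j)) * g' (z i)| ≤ M := by
      intro i z
      rw [abs_mul, abs_of_nonneg (Finset.prod_nonneg fun _ _ => h0 _), ← one_mul M]
      gcongr
      · exact Finset.prod_le_one (fun _ _ => h0 _) fun _ _ => h1 _
      · exact hM _
    have hF'eq : F' θ = fun p => ∑ i, W θ i p *
        ((∏ j ∈ Finset.univ.erase i, g (Z θ p j)) * g' (Z θ p i)) := by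
      ext p
      simp only [hF', smul_eq_mul]
      exact Finset.sum_congr rfl fun i _ => by ring
    rw [hF'eq, integral_finsetSum _ fun i _ => (hWint i).mul_bdd (c := M)
      (Continuous.aestronglyMeasurable (by fun_prop)) (ae_of_all _ fun p => key i _)]
    refine Finset.sum_nonneg fun i _ => ?_
    refine HasGaussianLaw.integral_mul_comp_nonneg (W := W θ i) (Z := Z θ) (M := M)
      (φ := fun z => (∏ j ∈ Finset.univ.erase i, g (z j)) * g' (z i)) (by fun_prop)
      (hZc θ).measurable ?_ ?_ ?_ (Continuous.measurable (by fun_prop)) (key i) ?_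
    · let T : ((ι → ℝ) × (ι → ℝ)) →L[ℝ] (ℝ × (ι → ℝ)) :=
        ((-Real.sin θ) • (ContinuousLinearMap.proj (R := ℝ) (φ := fun _ : ι => ℝ) i).comp
            (ContinuousLinearMap.fst ℝ (ι → ℝ) (ι → ℝ)) +
          (Real.cos θ) • (ContinuousLinearMap.proj (R := ℝ) (φ := fun _ : ι => ℝ) i).comp
            (ContinuousLinearMap.snd ℝ (ι → ℝ) (ι → ℝ))).prod
        ((Real.cos θ) • (ContinuousLinearMap.fst ℝ (ι → ℝ) (ι → ℝ)) +
          (Real.sin θ) • (ContinuousLinearMap.snd ℝ (ι → ℝ) (ι → ℝ)))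
      exact hid.map_fun T
    · have i1 : ∫ p, p.1 i ∂P = 0 := by
        rw [hP, integral_fun_fst (fun x : ι → ℝ => x i)]; simp [hμ i]
      have i2 : ∫ p, p.2 i ∂P = 0 := by
        rw [hP, integral_fun_snd (fun x : ι → ℝ => x i)]; simp [hν i]
      simp only [hW]
      rw [integral_add (((hpx i).integrable one_le_two).const_mul _)
        (((hpy i).integrable one_le_two).const_mul _), integral_const_mul, integral_const_mul,
        i1, i2]
      simp
    · intro j
      rw [hcov]
      refine mul_nonneg (mul_nonneg hs hc) (sub_nonneg.2 ?_)
      by_cases hij : i = j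
      · subst hij; exact (hdiag i).le
      · exact hoff i j hij
    · intro a ha haz z
      -- Equal variances make `W θ i` uncorrelated with `Z θ i`, so the argument of `g'`, which need
      -- not be monotone, stays fixed. Only the decreasing factors `g` move, against a nonpositive
      -- `g'`.
      have hai : a i = 0 := haz i (by rw [hcov, hdiag]; simp)
      simp only [Pi.add_apply, hai, add_zero]
      refine mul_le_mul_of_nonpos_right ?_ (hg'0 _)
      exact Finset.prod_le_prod (fun _ _ => h0 _) fun j _ => hanti (by linarith [ha j])
  have hmono : MonotoneOn (fun θ => ∫ p, ∏ i, g (Z θ p i) ∂P) (Set.Icc 0 (Real.pi / 2)) := by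
    refine monotoneOn_of_deriv_nonneg (convex_Icc _ _)
      (fun θ _ => (hder θ).continuousAt.continuousWithinAt)
      (fun θ _ => (hder θ).differentiableAt.differentiableWithinAt) fun θ hθ => ?_
    rw [(hder θ).deriv]
    exact hnn θ (interior_subset hθ)
  have hfin := hmono (Set.left_mem_Icc.2 (by positivity)) (Set.right_mem_Icc.2 (by positivity))
    (by positivity : (0 : ℝ) ≤ Real.pi / 2)
  simp only [hZ, Real.cos_zero, Real.sin_zero, Real.cos_pi_div_two, Real.sin_pi_div_two, one_mul,
    zero_mul, add_zero, zero_add] at hfin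
  rw [hP, integral_fun_fst (fun x : ι → ℝ => ∏ i, g (x i)),
    integral_fun_snd (fun x : ι → ℝ => ∏ i, g (x i))] at hfin
  simpa using hfin

/-- The derivative is continuous and vanishes off `[0, 1]`. The bound serves the differentiation
under the integral in the interpolation. -/
theorem exists_bound_deriv_smoothTransition :
    ∃ M : ℝ, ∀ x, |deriv Real.smoothTransition x| ≤ M := by
  have hc : Continuous (deriv Real.smoothTransition) :=
    (Real.smoothTransition.contDiff (n := 1)).continuous_deriv le_rfl
  refine hc.bounded_above_of_compact_support
    (HasCompactSupport.intro (isCompact_Icc (a := (0 : ℝ)) (b := 1)) fun x hx => ?_)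
  rw [Set.mem_Icc, not_and_or, not_le, not_le] at hx
  rcases hx with hx | hx
  · have : Real.smoothTransition =ᶠ[nhds x] fun _ => 0 := by
      filter_upwards [eventually_lt_nhds hx] with y hy
      exact Real.smoothTransition.zero_of_nonpos hy.le
    rw [this.deriv_eq]; simp
  · have : Real.smoothTransition =ᶠ[nhds x] fun _ => 1 := by
      filter_upwards [eventually_gt_nhds hx] with y hy
      exact Real.smoothTransition.one_of_one_le hy.le
    rw [this.deriv_eq]; simp

/-- **Slepian's inequality** for centered Gaussian measures on `ι → ℝ`. -/
theorem slepian_measure {ι : Type*} [Fintype ι]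
    (μ ν : Measure (ι → ℝ)) [IsGaussian μ] [IsGaussian ν]
    (hμ : ∀ i, ∫ x, x i ∂μ = 0) (hν : ∀ i, ∫ x, x i ∂ν = 0)
    (hdiag : ∀ i, cov[fun x => x i, fun x => x i; μ] = cov[fun x => x i, fun x => x i; ν])
    (hoff : ∀ i j, i ≠ j → cov[fun x => x i, fun x => x j; μ] ≤ cov[fun x => x i, fun x => x j; ν])
    (t : ℝ) : μ.real {x | ∀ i, x i ≤ t} ≤ ν.real {x | ∀ i, x i ≤ t} := by
  obtain ⟨M, hM⟩ := exists_bound_deriv_smoothTransition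
  -- `g k` equals `1` up to `t` and `0` from `t + 1 / k` on, so the products converge pointwise to
  -- the indicator of the closed orthant.
  let g : ℕ → ℝ → ℝ := fun k x => Real.smoothTransition (1 - k * (x - t))
  have hg0 : ∀ k x, 0 ≤ g k x := fun k x => Real.smoothTransition.nonneg _
  have hg1 : ∀ k x, g k x ≤ 1 := fun k x => Real.smoothTransition.le_one _
  have hgc : ∀ k, Continuous (g k) := fun k =>
    Real.smoothTransition.continuous.comp (by fun_prop)
  have hstep : ∀ k, ∫ x, ∏ i, g k (x i) ∂μ ≤ ∫ x, ∏ i, g k (x i) ∂ν := by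
    intro k
    refine integral_prod_le_of_covariance_le μ ν hμ hν hdiag hoff (g := g k)
      (g' := fun x => deriv Real.smoothTransition (1 - k * (x - t)) * (-(k * 1))) (M := M * k)
      (fun x => ?_) ?_ (fun x => ?_) ?_ (hg0 k) (hg1 k)
    · exact ((Real.smoothTransition.contDiff (n := 1)).differentiable one_ne_zero
        _).hasDerivAt.comp x ((((hasDerivAt_id x).sub_const t).const_mul (k : ℝ)).const_sub 1)
    · exact (((Real.smoothTransition.contDiff (n := 1)).continuous_deriv le_rfl).comp
        (by fun_prop)).mul continuous_const
    · rw [abs_mul, abs_neg, mul_one, Nat.abs_cast]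
      exact mul_le_mul_of_nonneg_right (hM _) (Nat.cast_nonneg k)
    · intro x y hxy
      refine Real.smoothTransition.monotone ?_
      gcongr
  have hms : MeasurableSet {x : ι → ℝ | ∀ i, x i ≤ t} := by measurability
  have hlim : ∀ (m : Measure (ι → ℝ)) [IsProbabilityMeasure m],
      Filter.Tendsto (fun k => ∫ x, ∏ i, g k (x i) ∂m) Filter.atTop
        (nhds (m.real {x | ∀ i, x i ≤ t})) := by
    intro m _
    rw [← integral_indicator_one hms]
    refine tendsto_integral_of_dominated_convergence (fun _ => 1) (fun k => ?_)
      (integrable_const _) (fun k => ae_of_all _ fun x => ?_) (ae_of_all _ fun x => ?_)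
    · exact Continuous.aestronglyMeasurable
        (continuous_finsetProd _ fun i _ => (hgc k).comp (continuous_apply i))
    · rw [Real.norm_eq_abs, abs_of_nonneg (Finset.prod_nonneg fun _ _ => hg0 k _)]
      exact Finset.prod_le_one (fun _ _ => hg0 k _) fun _ _ => hg1 k _
    · by_cases hx : ∀ i, x i ≤ t
      · rw [Set.indicator_of_mem (by exact hx)]
        refine tendsto_const_nhds.congr fun k => ?_
        symm
        refine Finset.prod_eq_one fun i _ => Real.smoothTransition.one_of_one_le ?_
        have : (k : ℝ) * (x i - t) ≤ 0 :=
          mul_nonpos_of_nonneg_of_nonpos (Nat.cast_nonneg k) (by linarith [hx i])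
        linarith
      · rw [Set.indicator_of_notMem (by exact hx)]
        push Not at hx
        obtain ⟨i, hi⟩ := hx
        obtain ⟨N, hN⟩ := exists_nat_gt (1 / (x i - t))
        refine tendsto_const_nhds.congr' ?_
        filter_upwards [Filter.eventually_ge_atTop N] with k hk
        symm
        refine Finset.prod_eq_zero (Finset.mem_univ i) (Real.smoothTransition.zero_of_nonpos ?_)
        have hpos : 0 < x i - t := by linarith
        rw [div_lt_iff₀ hpos] at hN
        have : (N : ℝ) * (x i - t) ≤ k * (x i - t) := by gcongr
        linarith
  exact le_of_tendsto_of_tendsto' (hlim μ) (hlim ν) hstep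

/-! ### The equicorrelated Gaussian law -/

/-- The law on `ι → ℝ` of `√(1 - ρ) (G i - W)`, with `G i` independent standard normal variables
and `W` an independent centered normal variable of variance `ρ / (1 - ρ)`: the centered Gaussian
law with unit variances and all correlations equal to `ρ`. -/
noncomputable def equicorrelatedGaussian (ι : Type*) [Fintype ι] (ρ : ℝ) : Measure (ι → ℝ) :=
  ((gaussianReal 0 (ρ / (1 - ρ)).toNNReal).prod (Measure.pi fun _ : ι => gaussianReal 0 1)).map
    fun p i => √(1 - ρ) * (p.2 i - p.1)

instance isGaussian_pi_gaussianReal {ι : Type*} [Fintype ι] :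
    IsGaussian (Measure.pi fun _ : ι => gaussianReal 0 1) := by
  have h := iIndepFun.hasGaussianLaw (P := Measure.pi fun _ : ι => gaussianReal 0 1)
    (X := fun i (x : ι → ℝ) => x i) (fun i => ?_)
    (iIndepFun_pi (X := fun _ => id) fun _ => aemeasurable_id)
  · simpa using! h.isGaussian_map
  · constructor
    have := (measurePreserving_eval (fun _ : ι => gaussianReal 0 1) i).map_eq
    rw [show (fun x : ι → ℝ => x i) = Function.eval i from rfl, this]
    infer_instance

instance isGaussian_equicorrelatedGaussian {ι : Type*} [Fintype ι] (ρ : ℝ) :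
    IsGaussian (equicorrelatedGaussian ι ρ) := by
  let T : (ℝ × (ι → ℝ)) →L[ℝ] (ι → ℝ) :=
    √(1 - ρ) • (ContinuousLinearMap.snd ℝ ℝ (ι → ℝ) -
      ContinuousLinearMap.pi fun _ => ContinuousLinearMap.fst ℝ ℝ (ι → ℝ))
  exact isGaussian_map (μ := (gaussianReal 0 (ρ / (1 - ρ)).toNNReal).prod
    (Measure.pi fun _ : ι => gaussianReal 0 1)) T

theorem covariance_eval_pi_gaussianReal {ι : Type*} [Fintype ι] [DecidableEq ι] (i j : ι) :
    cov[fun x => x i, fun x => x j; Measure.pi fun _ : ι => gaussianReal 0 1]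
      = if i = j then 1 else 0 := by
  set P := Measure.pi fun _ : ι => gaussianReal 0 1
  have hL : ∀ i, MemLp (fun x : ι → ℝ => x i) 2 P := fun i =>
    (HasGaussianLaw.eval (X := fun i (x : ι → ℝ) => x i) IsGaussian.hasGaussianLaw_id i).memLp_two
  split_ifs with h
  · subst h
    rw [covariance_self (measurable_pi_apply i).aemeasurable]
    have := variance_id_map (μ := P) (X := fun x : ι → ℝ => x i)
      (measurable_pi_apply i).aemeasurable
    rw [← this, show (fun x : ι → ℝ => x i) = Function.eval i from rfl,
      (measurePreserving_eval (fun _ : ι => gaussianReal 0 1) i).map_eq, variance_id_gaussianReal]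
    simp
  · exact ((iIndepFun_pi (μ := fun _ : ι => gaussianReal 0 1) (X := fun _ => id)
      fun _ => aemeasurable_id).indepFun h).covariance_eq_zero (hL i) (hL j)

theorem integral_eval_pi_gaussianReal {ι : Type*} [Fintype ι] (i : ι) :
    ∫ x, x i ∂(Measure.pi fun _ : ι => gaussianReal 0 1) = 0 := by
  have h := integral_map (μ := Measure.pi fun _ : ι => gaussianReal 0 1) (φ := Function.eval i)
    (f := fun x : ℝ => x) (measurable_pi_apply i).aemeasurable (by fun_prop)
  rw [(measurePreserving_eval (fun _ : ι => gaussianReal 0 1) i).map_eq,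
    integral_id_gaussianReal] at h
  exact h.symm

theorem integral_eval_equicorrelatedGaussian {ι : Type*} [Fintype ι] (ρ : ℝ) (i : ι) :
    ∫ x, x i ∂(equicorrelatedGaussian ι ρ) = 0 := by
  rw [equicorrelatedGaussian, integral_map (by fun_prop)
    (f := fun x : ι → ℝ => x i) (measurable_pi_apply i).aestronglyMeasurable, integral_const_mul,
    integral_sub]
  · rw [integral_fun_snd (fun x : ι → ℝ => x i), integral_fun_fst (fun x : ℝ => x),
      integral_eval_pi_gaussianReal, integral_id_gaussianReal]
    simp
  · exact ((HasGaussianLaw.eval (X := fun i (x : ι → ℝ) => x i)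
      (IsGaussian.hasGaussianLaw_id (μ := Measure.pi fun _ : ι => gaussianReal 0 1))
      i).integrable).comp_snd _
  · exact ((IsGaussian.hasGaussianLaw_id
      (μ := gaussianReal 0 (ρ / (1 - ρ)).toNNReal)).integrable).comp_fst _

theorem covariance_eval_equicorrelatedGaussian {ι : Type*} [Fintype ι] [DecidableEq ι] {ρ : ℝ}
    (hρ : ρ ∈ Set.Ioo (0 : ℝ) 1) (i j : ι) :
    cov[fun x => x i, fun x => x j; equicorrelatedGaussian ι ρ] = if i = j then 1 else ρ := by
  have hL : ∀ i, MemLp (fun p : ℝ × (ι → ℝ) => p.2 i) 2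
      ((gaussianReal 0 (ρ / (1 - ρ)).toNNReal).prod (Measure.pi fun _ : ι => gaussianReal 0 1)) :=
    fun i => (HasGaussianLaw.eval (X := fun i (x : ι → ℝ) => x i)
      (IsGaussian.hasGaussianLaw_id (μ := Measure.pi fun _ : ι => gaussianReal 0 1))
      i).memLp_two.comp_snd _
  have hW : MemLp (fun p : ℝ × (ι → ℝ) => p.1) 2
      ((gaussianReal 0 (ρ / (1 - ρ)).toNNReal).prod (Measure.pi fun _ : ι => gaussianReal 0 1)) :=
    (IsGaussian.hasGaussianLaw_id
      (μ := gaussianReal 0 (ρ / (1 - ρ)).toNNReal)).memLp_two.comp_fst _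
  have h1 : 0 < 1 - ρ := by linarith [hρ.2]
  rw [equicorrelatedGaussian, covariance_map_fun (measurable_pi_apply i).aestronglyMeasurable
    (measurable_pi_apply j).aestronglyMeasurable (by fun_prop), covariance_const_mul_left,
    covariance_const_mul_right, covariance_fun_sub_fun_sub (hL i) hW (hL j) hW]
  have e1 : cov[fun p : ℝ × (ι → ℝ) => p.2 i, fun p => p.2 j; (gaussianReal 0
      (ρ / (1 - ρ)).toNNReal).prod (Measure.pi fun _ : ι => gaussianReal 0 1)]
        = if i = j then 1 else 0 := by
    have h := covariance_map_fun (μ := (gaussianReal 0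
      (ρ / (1 - ρ)).toNNReal).prod (Measure.pi fun _ : ι => gaussianReal 0 1)) (Z := Prod.snd)
      (X := fun x : ι → ℝ => x i)
      (Y := fun x => x j) (measurable_pi_apply i).aestronglyMeasurable
        (measurable_pi_apply j).aestronglyMeasurable (by fun_prop)
    rw [← h, Measure.map_snd_prod, ← covariance_eval_pi_gaussianReal]; simp
  have e2 : ∀ i, cov[fun p : ℝ × (ι → ℝ) => p.1, fun p => p.2 i; (gaussianReal 0
      (ρ / (1 - ρ)).toNNReal).prod (Measure.pi fun _ : ι => gaussianReal 0 1)] = 0 := fun i =>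
    covariance_fst_snd_prod (X := fun x : ℝ => x) (Y := fun x : ι → ℝ => x i)
      IsGaussian.hasGaussianLaw_id.memLp_two
      (HasGaussianLaw.eval (X := fun i (x : ι → ℝ) => x i)
        IsGaussian.hasGaussianLaw_id i).memLp_two
  have e3 : cov[fun p : ℝ × (ι → ℝ) => p.1, fun p => p.1; (gaussianReal 0
      (ρ / (1 - ρ)).toNNReal).prod (Measure.pi fun _ : ι => gaussianReal 0 1)] = ρ / (1 - ρ) := by
    rw [covariance_self (by fun_prop)]
    have := variance_id_map (μ := (gaussianReal 0
      (ρ / (1 - ρ)).toNNReal).prod (Measure.pi fun _ : ι => gaussianReal 0 1))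
      (X := Prod.fst) (by fun_prop)
    rw [Measure.map_fst_prod, measure_univ, one_smul] at this
    have h2 : Var[id; gaussianReal 0 (ρ / (1 - ρ)).toNNReal] = ρ / (1 - ρ) := by
      rw [variance_id_gaussianReal, Real.coe_toNNReal _ (div_nonneg hρ.1.le h1.le)]
    exact this.symm.trans h2
  rw [covariance_comm (fun p : ℝ × (ι → ℝ) => p.2 i) (fun p => p.1), e1, e2, e2, e3, ← mul_assoc,
    Real.mul_self_sqrt h1.le]
  split_ifs <;> field_simp <;> ring

/-- Given the common variable `w`, the constraints on the coordinates are independent and each reads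
`G i ≤ t + w`. -/
theorem equicorrelatedGaussian_real_Iic {ι : Type*} [Fintype ι] {ρ : ℝ}
    (hρ : ρ ∈ Set.Ioo (0 : ℝ) 1) (t : ℝ) :
    (equicorrelatedGaussian ι ρ).real {x | ∀ i, x i ≤ √(1 - ρ) * t} =
      ∫ w, cdf (gaussianReal 0 1) (t + w) ^ Fintype.card ι
        ∂(gaussianReal 0 (ρ / (1 - ρ)).toNNReal) := by
  have h1 : 0 < √(1 - ρ) := Real.sqrt_pos.2 (by linarith [hρ.2])
  have hms : MeasurableSet {x : ι → ℝ | ∀ i, x i ≤ √(1 - ρ) * t} := by measurability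
  have hmeas : Measurable fun (p : ℝ × (ι → ℝ)) (i : ι) => √(1 - ρ) * (p.2 i - p.1) := by fun_prop
  rw [equicorrelatedGaussian, map_measureReal_apply hmeas hms, Measure.real,
    Measure.prod_apply (hmeas hms)]
  have : ∀ w : ℝ, (Measure.pi fun _ : ι => gaussianReal 0 1) (Prod.mk w ⁻¹'
      ((fun (p : ℝ × (ι → ℝ)) (i : ι) => √(1 - ρ) * (p.2 i - p.1)) ⁻¹'
        {x | ∀ i, x i ≤ √(1 - ρ) * t}))
      = ENNReal.ofReal (cdf (gaussianReal 0 1) (t + w) ^ Fintype.card ι) := by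
    intro w
    have e : (Prod.mk w ⁻¹' ((fun (p : ℝ × (ι → ℝ)) (i : ι) => √(1 - ρ) * (p.2 i - p.1)) ⁻¹'
        {x | ∀ i, x i ≤ √(1 - ρ) * t})) = Set.univ.pi fun _ : ι => Set.Iic (t + w) := by
      ext x
      simp only [Set.mem_preimage, Set.mem_ofPred_eq, Set.mem_univ_pi, Set.mem_Iic]
      refine forall_congr' fun i => ?_
      rw [mul_le_mul_iff_right₀ h1, sub_le_iff_le_add]
    rw [e, Measure.pi_pi, Finset.prod_const, Finset.card_univ, ← ofReal_cdf,
      ENNReal.ofReal_pow (cdf_nonneg _ _)]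
  simp_rw [this]
  rw [integral_eq_lintegral_of_nonneg_ae (ae_of_all _ fun w => pow_nonneg (cdf_nonneg _ _) _)]
  exact (((monotone_cdf _).measurable.comp (measurable_const.add measurable_id)).pow_const
    _).aestronglyMeasurable

/-! ### Comparison of a general vector with the equicorrelated one -/

section Comparison

variable {Ω ι : Type*} [MeasurableSpace Ω] {X : ι → Ω → ℝ}
  {P : Measure Ω} {ρ : ℝ}

theorem IsStandardizedGaussianVector.measureReal_iSup_le_eq [Fintype ι] [Nonempty ι]
    (hX : IsStandardizedGaussianVector X P)
    (t : ℝ) :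
    P.real {ω | (⨆ i, X i ω) ≤ t} = (P.map fun ω i => X i ω).real {x | ∀ i, x i ≤ t} := by
  have hms : MeasurableSet {x : ι → ℝ | ∀ i, x i ≤ t} := by measurability
  have e : {ω | (⨆ i, X i ω) ≤ t} = (fun ω i => X i ω) ⁻¹' {x | ∀ i, x i ≤ t} := by
    ext ω
    exact ciSup_le_iff (Set.finite_range fun i => X i ω).bddAbove
  rw [e, Measure.real, Measure.real, Measure.map_apply_of_aemeasurable
    hX.hasGaussianLaw.aemeasurable hms]

theorem IsStandardizedGaussianVector.integral_eval_map (hX : IsStandardizedGaussianVector X P)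
    (i : ι) : ∫ x, x i ∂(P.map fun ω i => X i ω) = 0 := by
  rw [integral_map hX.hasGaussianLaw.aemeasurable (measurable_pi_apply i).aestronglyMeasurable]
  exact hX.mean_eq_zero i

theorem IsStandardizedGaussianVector.covariance_eval_map (hX : IsStandardizedGaussianVector X P)
    (i j : ι) : cov[fun x => x i, fun x => x j; P.map fun ω i => X i ω]
      = correlationMatrix X P i j := by
  rw [covariance_map_fun (measurable_pi_apply i).aestronglyMeasurable
    (measurable_pi_apply j).aestronglyMeasurable hX.hasGaussianLaw.aemeasurable]
  simp [correlationMatrix, hX.variance_eq_one]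

theorem IsStandardizedGaussianVector.covariance_eval_map_self
    (hX : IsStandardizedGaussianVector X P)
    (i : ι) : cov[fun x => x i, fun x => x i; P.map fun ω i => X i ω] = 1 := by
  rw [covariance_map_fun (measurable_pi_apply i).aestronglyMeasurable
    (measurable_pi_apply i).aestronglyMeasurable hX.hasGaussianLaw.aemeasurable,
    covariance_self (hX.hasGaussianLaw.eval i).aemeasurable]
  exact hX.variance_eq_one i

theorem IsStandardizedGaussianVector.measureReal_iSup_le_le [Fintype ι] [Nonempty ι]
   
    (hX : IsStandardizedGaussianVector X P) (hρ : ρ ∈ Set.Ioo (0 : ℝ) 1)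
    (hR : ∀ i j, i ≠ j → correlationMatrix X P i j ≤ ρ) (t : ℝ) :
    P.real {ω | (⨆ i, X i ω) ≤ √(1 - ρ) * t} ≤
      ∫ w, cdf (gaussianReal 0 1) (t + w) ^ Fintype.card ι
        ∂(gaussianReal 0 (ρ / (1 - ρ)).toNNReal) := by
  classical
  have := hX.hasGaussianLaw.isGaussian_map
  rw [← equicorrelatedGaussian_real_Iic hρ, hX.measureReal_iSup_le_eq]
  refine slepian_measure _ _ hX.integral_eval_map (integral_eval_equicorrelatedGaussian ρ)
    (fun i => ?_) (fun i j hij => ?_) _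
  · rw [hX.covariance_eval_map_self, covariance_eval_equicorrelatedGaussian hρ, if_pos rfl]
  · rw [hX.covariance_eval_map, covariance_eval_equicorrelatedGaussian hρ, if_neg hij]
    exact hR i j hij

theorem IsStandardizedGaussianVector.le_measureReal_iSup_le [Fintype ι] [Nonempty ι]
   
    (hX : IsStandardizedGaussianVector X P) (hρ : ρ ∈ Set.Ioo (0 : ℝ) 1)
    (hR : ∀ i j, i ≠ j → ρ ≤ correlationMatrix X P i j) (t : ℝ) :
    ∫ w, cdf (gaussianReal 0 1) (t + w) ^ Fintype.card ι
        ∂(gaussianReal 0 (ρ / (1 - ρ)).toNNReal) ≤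
      P.real {ω | (⨆ i, X i ω) ≤ √(1 - ρ) * t} := by
  classical
  have := hX.hasGaussianLaw.isGaussian_map
  rw [← equicorrelatedGaussian_real_Iic hρ, hX.measureReal_iSup_le_eq]
  refine slepian_measure _ _ (integral_eval_equicorrelatedGaussian ρ) hX.integral_eval_map
    (fun i => ?_) (fun i j hij => ?_) _
  · rw [hX.covariance_eval_map_self, covariance_eval_equicorrelatedGaussian hρ, if_pos rfl]
  · rw [hX.covariance_eval_map, covariance_eval_equicorrelatedGaussian hρ, if_neg hij]
    exact hR i j hij

end Comparison

/-! ### Standard normal tail estimates -/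

theorem one_sub_cdf_gaussianReal (u : ℝ) :
    1 - cdf (gaussianReal 0 1) u = ∫ x in Set.Ioi u, gaussianPDFReal 0 1 x := by
  have h : (gaussianReal 0 1).real (Set.Ioi u) = ∫ x in Set.Ioi u, gaussianPDFReal 0 1 x := by
    rw [Measure.real, gaussianReal_apply_eq_integral _ one_ne_zero, ENNReal.toReal_ofReal]
    exact integral_nonneg fun x => gaussianPDFReal_nonneg _ _ _
  rw [cdf_eq_real, ← h, ← Set.compl_Iic, probReal_compl_eq_one_sub measurableSet_Iic]

theorem gaussianPDFReal_zero_one (x : ℝ) :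
    gaussianPDFReal 0 1 x = (√(2 * Real.pi))⁻¹ * Real.exp (-(x ^ 2) / 2) := by
  simp [gaussianPDFReal]

/-- The tangent line bound `-x² / 2 ≤ u² / 2 - u x` replaces the density by an integrable
exponential; `√(2π) ≥ 2` supplies the constant. -/
theorem one_sub_cdf_gaussianReal_le {u : ℝ} (hu : 0 < u) :
    1 - cdf (gaussianReal 0 1) u ≤ Real.exp (-(u ^ 2) / 2) / (2 * u) := by
  have hs : (√(2 * Real.pi))⁻¹ ≤ 1 / 2 := by
    rw [inv_eq_one_div]
    refine one_div_le_one_div_of_le two_pos (Real.le_sqrt_of_sq_le ?_)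
    linarith [Real.pi_gt_three]
  have hint := integrableOn_exp_mul_Ioi (a := -u) (by linarith) u
  calc 1 - cdf (gaussianReal 0 1) u = ∫ x in Set.Ioi u, gaussianPDFReal 0 1 x :=
        one_sub_cdf_gaussianReal u
    _ ≤ ∫ x in Set.Ioi u, 1 / 2 * Real.exp (u ^ 2 / 2) * Real.exp (-u * x) := by
        refine setIntegral_mono_on (integrable_gaussianPDFReal _ _).integrableOn
          (hint.const_mul _) measurableSet_Ioi fun x _ => ?_
        rw [gaussianPDFReal_zero_one, mul_assoc, ← Real.exp_add]
        gcongr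
        nlinarith [sq_nonneg (x - u)]
    _ = Real.exp (-(u ^ 2) / 2) / (2 * u) := by
        rw [integral_const_mul, integral_exp_mul_Ioi (by linarith)]
        have : Real.exp (-(u ^ 2) / 2) = Real.exp (u ^ 2 / 2) * Real.exp (-u * u) := by
          rw [← Real.exp_add]; congr 1; ring
        rw [this]
        field_simp

/-- Only the interval from `u` to `u + 1 / (1 + u)` is kept; on it the square exceeds `u²` by at
most `3`. -/
theorem le_one_sub_cdf_gaussianReal {u : ℝ} (hu : 0 ≤ u) :
    Real.exp (-(u ^ 2) / 2 - 3 / 2) / (3 * (1 + u)) ≤ 1 - cdf (gaussianReal 0 1) u := by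
  have hs : 1 / 3 ≤ (√(2 * Real.pi))⁻¹ := by
    rw [inv_eq_one_div]
    refine one_div_le_one_div_of_le (by positivity) (Real.sqrt_le_iff.2 ⟨by norm_num, ?_⟩)
    linarith [Real.pi_lt_four]
  set h := 1 / (1 + u) with hh
  have h0 : 0 < h := by positivity
  have hu1 : u * h ≤ 1 := by rw [hh, mul_one_div, div_le_one (by positivity)]; linarith
  have h1 : h ≤ 1 := by rw [hh, div_le_one (by positivity)]; linarith
  rw [one_sub_cdf_gaussianReal]
  calc Real.exp (-(u ^ 2) / 2 - 3 / 2) / (3 * (1 + u))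
      = ∫ _ in Set.Ioc u (u + h), 1 / 3 * Real.exp (-(u ^ 2) / 2 - 3 / 2) := by
        rw [setIntegral_const, Real.volume_real_Ioc_of_le (by linarith), smul_eq_mul, hh]
        field_simp
        ring
    _ ≤ ∫ x in Set.Ioc u (u + h), gaussianPDFReal 0 1 x := by
        refine setIntegral_mono_on (integrableOn_const (by simp))
          (integrable_gaussianPDFReal _ _).integrableOn measurableSet_Ioc fun x hx => ?_
        rw [gaussianPDFReal_zero_one]
        gcongr
        have : x ^ 2 ≤ (u + h) ^ 2 := pow_le_pow_left₀ (by linarith [hx.1]) hx.2 2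
        nlinarith
    _ ≤ ∫ x in Set.Ioi u, gaussianPDFReal 0 1 x := by
        refine setIntegral_mono_set (integrable_gaussianPDFReal _ _).integrableOn
          (ae_of_all _ fun x => gaussianPDFReal_nonneg _ _ _) ?_
        exact Set.Ioc_subset_Ioi_self.eventuallyLE

/-- Applied to `l = log n`, it bounds the square of the shift `log l / 2` by `l`. The threshold `2 /
3` lies below `log 2`, so every `n ≥ 2` is covered. -/
theorem abs_log_le_two_mul_sqrt {l : ℝ} (hl : 2 / 3 ≤ l) : |Real.log l| ≤ 2 * √l := by
  have h0 : 0 < l := by linarith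
  have hs : 0 < √l := Real.sqrt_pos.2 h0
  have hs2 : √l ^ 2 = l := Real.sq_sqrt h0.le
  rw [abs_le]
  constructor
  · have h := Real.one_sub_inv_le_log_of_pos h0
    have : l⁻¹ ≤ 3 / 2 := by
      rw [inv_le_comm₀ h0 (by norm_num)]; linarith
    nlinarith
  · have h := Real.log_le_sub_one_of_pos hs
    have e : Real.log l = 2 * Real.log √l := by
      rw [← Real.log_rpow hs 2]; norm_num [hs2]
    linarith

theorem exp_half_log {l : ℝ} (hl : 0 < l) : Real.exp (Real.log l / 2) = √l := by
  rw [← Real.log_sqrt hl.le, Real.exp_log (Real.sqrt_pos.2 hl)]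

/-- If `s ≥ -(log l) / 2`, the standard normal tail at `√(2l) + s / √(2l)` is at most
`exp (-l) / 2`. -/
theorem one_sub_cdf_gaussianReal_le_exp_neg {l s : ℝ} (hl : 2 / 3 ≤ l) (hs : -(Real.log l / 2) ≤ s) :
    1 - cdf (gaussianReal 0 1) (√(2 * l) + s / √(2 * l)) ≤ Real.exp (-l) / 2 := by
  have h0 : 0 < l := by linarith
  set L := √(2 * l) with hL
  have hLp : 0 < L := Real.sqrt_pos.2 (by linarith)
  have hL2 : L ^ 2 = 2 * l := Real.sq_sqrt (by linarith)
  have hr : 0 < √l := Real.sqrt_pos.2 h0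
  have hr2 : √l ^ 2 = l := Real.sq_sqrt h0.le
  have hlog := Real.log_le_sub_one_of_pos h0
  have hsl : -(L / 4) ≤ s / L := by
    rw [le_div_iff₀ hLp]; nlinarith
  have hLr : 4 / 3 * √l ≤ L := by
    refine Real.le_sqrt_of_sq_le ?_
    rw [mul_pow, hr2]; linarith
  have hu : √l ≤ L + s / L := by linarith
  refine (one_sub_cdf_gaussianReal_le (hr.trans_le hu)).trans ?_
  have hsq : (L + s / L) ^ 2 = 2 * l + 2 * s + (s / L) ^ 2 := by
    rw [add_sq, hL2]; field_simp
  rw [div_le_div_iff₀ (by linarith) two_pos]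
  calc Real.exp (-(L + s / L) ^ 2 / 2) * 2 ≤ Real.exp (-l + Real.log l / 2) * 2 := by
        gcongr
        rw [hsq]
        nlinarith [sq_nonneg (s / L)]
    _ = Real.exp (-l) * (2 * √l) := by rw [Real.exp_add, exp_half_log h0]; ring
    _ ≤ _ := by gcongr

/-- The main terms give `exp (-l + y)`, and the quadratic term `s² / (4 l)` costs at most `1 + 5 y /
8`, which leaves the rate `3 / 8`. This cost is linear in `y` because `hu` forces `y + log l / 2 ≤ 2
l`. -/
theorem le_one_sub_cdf_gaussianReal_exp {l y : ℝ} (hl : 2 / 3 ≤ l) (hy : 0 ≤ y)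
    (hu : 0 ≤ √(2 * l) + (-y - Real.log l / 2) / √(2 * l)) :
    Real.exp (-l) * (Real.exp (-5 / 2) / 15 * Real.exp (3 / 8 * y)) ≤
      1 - cdf (gaussianReal 0 1) (√(2 * l) + (-y - Real.log l / 2) / √(2 * l)) := by
  have h0 : 0 < l := by linarith
  set L := √(2 * l) with hL
  have hLp : 0 < L := Real.sqrt_pos.2 (by linarith)
  have hL2 : L ^ 2 = 2 * l := Real.sq_sqrt (by linarith)
  have hr : 0 < √l := Real.sqrt_pos.2 h0
  have hr2 : √l ^ 2 = l := Real.sq_sqrt h0.le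
  have hr45 : 4 / 5 ≤ √l := Real.le_sqrt_of_sq_le (by norm_num; linarith)
  have hlog := Real.log_le_sub_one_of_pos h0
  have hlog2 := abs_le.1 (abs_log_le_two_mul_sqrt hl)
  refine le_trans ?_ (le_one_sub_cdf_gaussianReal hu)
  set a0 := Real.log l / 2 with ha0
  set s := -y - a0 with hs
  have hLr : L ≤ 3 / 2 * √l := by
    refine Real.sqrt_le_iff.2 ⟨by positivity, ?_⟩
    rw [mul_pow, hr2]; linarith
  have hLr' : √l ≤ L := Real.sqrt_le_sqrt (by linarith)
  have hsL : s / L ≤ 1 := by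
    rw [div_le_one hLp]; linarith [hlog2.1]
  have hs2l : -(2 * l) ≤ s := by
    have : (L + s / L) * L = 2 * l + s := by rw [← hL2]; field_simp
    nlinarith [mul_nonneg hu hLp.le]
  have hsq : (L + s / L) ^ 2 = 2 * l + 2 * s + s ^ 2 / (2 * l) := by
    rw [add_sq, div_pow, hL2]; field_simp
  have hq : s ^ 2 / (4 * l) ≤ 1 + 5 / 8 * y := by
    rw [div_le_iff₀ (by linarith)]
    have e1 : a0 ^ 2 ≤ l := by
      rw [← hr2]; exact sq_le_sq' (by linarith [hlog2.1]) (by linarith [hlog2.2])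
    have e2 : y * (y + 2 * a0) ≤ y * (5 / 2 * l) := by
      refine mul_le_mul_of_nonneg_left ?_ hy
      linarith
    nlinarith
  have hq' : s ^ 2 / (2 * l) = 2 * (s ^ 2 / (4 * l)) := by field_simp; ring
  rw [le_div_iff₀ (by linarith)]
  calc Real.exp (-l) * (Real.exp (-5 / 2) / 15 * Real.exp (3 / 8 * y)) * (3 * (1 + (L + s / L)))
      ≤ Real.exp (-l) * (Real.exp (-5 / 2) / 15 * Real.exp (3 / 8 * y)) * (3 * (5 * √l)) := by
        gcongr
        linarith
    _ = Real.exp (-l + -5 / 2 + 3 / 8 * y + a0) := by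
        rw [Real.exp_add, Real.exp_add, Real.exp_add, exp_half_log h0]; ring
    _ ≤ _ := by
        gcongr
        rw [hsq, hq']
        linarith

/-! ### The power of the distribution function in the rescaled variable -/

theorem exists_exp_neg_mul_exp_le {c b : ℝ} (hc : 0 < c) (hb : 0 < b) (B : ℝ) :
    ∃ C : ℝ, 0 < C ∧ ∀ y, 0 ≤ y → Real.exp (-(c * Real.exp (b * y))) ≤ C * Real.exp (-(B * y)) := by
  obtain ⟨k, hk⟩ := exists_nat_ge (B / b)
  refine ⟨k.factorial / c ^ k, by positivity, fun y hy => ?_⟩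
  rw [div_le_iff₀ hb] at hk
  have h1 := Real.pow_div_factorial_le_exp (x := c * Real.exp (b * y)) (by positivity) k
  have h2 : Real.exp (B * y) ≤ Real.exp (b * y) ^ k := by
    rw [← Real.exp_nat_mul]
    refine Real.exp_le_exp.2 ?_
    nlinarith [mul_le_mul_of_nonneg_right hk hy]
  rw [mul_pow] at h1
  have h3 : c ^ k * Real.exp (B * y) / k.factorial ≤ Real.exp (c * Real.exp (b * y)) := by
    refine le_trans ?_ h1
    gcongr
  rw [Real.exp_neg, Real.exp_neg]
  calc _ ≤ (c ^ k * Real.exp (B * y) / k.factorial)⁻¹ := by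
        gcongr
    _ = _ := by field_simp

theorem pow_cdf_gaussianReal_le (n : ℕ) (u : ℝ) :
    cdf (gaussianReal 0 1) u ^ n ≤ Real.exp (-(n * (1 - cdf (gaussianReal 0 1) u))) := by
  have h := Real.add_one_le_exp (-(1 - cdf (gaussianReal 0 1) u))
  calc _ ≤ Real.exp (-(1 - cdf (gaussianReal 0 1) u)) ^ n :=
        pow_le_pow_left₀ (cdf_nonneg _ _) (by linarith) n
    _ = _ := by rw [← Real.exp_nat_mul]; congr 1; ring

/-- An integrable majorant, uniform in `n`. For `v ≥ 0` the factor `exp (-β v)` suffices; for `v ≤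
0` the doubly exponential decay of the power absorbs its growth. -/
theorem exists_pow_cdf_le {β : ℝ} :
    ∃ C : ℝ, 0 < C ∧ ∀ (n : ℕ) (v : ℝ), 2 ≤ n →
      0 ≤ √(2 * Real.log n) + (v - Real.log (Real.log n) / 2) / √(2 * Real.log n) →
      cdf (gaussianReal 0 1)
          (√(2 * Real.log n) + (v - Real.log (Real.log n) / 2) / √(2 * Real.log n)) ^ n
        * Real.exp (-(β * v)) ≤ C * Real.exp (-(min β 1 * |v|)) := by
  -- Rate `β + 1`: one unit of decay is left after cancelling `exp (β |v|)`.
  obtain ⟨C, hC, h⟩ := exists_exp_neg_mul_exp_le (c := Real.exp (-5 / 2) / 15) (b := 3 / 8)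
    (by positivity) (by norm_num) (β + 1)
  refine ⟨C + 1, by positivity, fun n v hn hu => ?_⟩
  have hn2 : (2 : ℝ) ≤ n := by exact_mod_cast hn
  have hl : 2 / 3 ≤ Real.log n := by
    have := Real.log_le_log two_pos hn2
    linarith [Real.log_two_gt_d9]
  rcases le_total 0 v with hv | hv
  · have h1 : cdf (gaussianReal 0 1)
        (√(2 * Real.log n) + (v - Real.log (Real.log n) / 2) / √(2 * Real.log n)) ^ n ≤ 1 :=
      pow_le_one₀ (cdf_nonneg _ _) (cdf_le_one _ _)
    have h2 : Real.exp (-(β * v)) ≤ Real.exp (-(min β 1 * |v|)) := by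
      rw [abs_of_nonneg hv]
      gcongr
      exact min_le_left _ _
    calc _ ≤ 1 * Real.exp (-(min β 1 * |v|)) := by gcongr
      _ ≤ _ := by gcongr; linarith
  · have h1 := le_one_sub_cdf_gaussianReal_exp hl (y := -v) (by linarith) (by rwa [neg_neg])
    rw [neg_neg] at h1
    have h2 := h (-v) (by linarith)
    rw [abs_of_nonpos hv]
    have h3 := pow_cdf_gaussianReal_le n
      (√(2 * Real.log n) + (v - Real.log (Real.log n) / 2) / √(2 * Real.log n))
    have h4 : (n : ℝ) * Real.exp (-Real.log n) = 1 := by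
      rw [Real.exp_neg, Real.exp_log (by linarith)]; field_simp
    have h5 := mul_le_mul_of_nonneg_left h1 (by linarith : (0 : ℝ) ≤ n)
    rw [← mul_assoc, h4, one_mul] at h5
    calc _ ≤ (C * Real.exp (-((β + 1) * -v))) * Real.exp (-(β * v)) := by
          gcongr
          exact h3.trans ((Real.exp_le_exp.2 (neg_le_neg h5)).trans h2)
      _ = C * Real.exp (-(1 * -v)) := by
          rw [mul_assoc, ← Real.exp_add]; congr 2; ring
      _ ≤ (C + 1) * Real.exp (-(min β 1 * -v)) := by
          gcongr
          · linarith
          · linarith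
          · exact min_le_right _ _

/-- The tail is at most `1 / (2 n)` here, and Bernoulli's inequality concludes. -/
theorem half_le_pow_cdf {n : ℕ} (hn : 2 ≤ n) {v : ℝ} (hv : 0 ≤ v) :
    1 / 2 ≤ cdf (gaussianReal 0 1)
      (√(2 * Real.log n) + (v - Real.log (Real.log n) / 2) / √(2 * Real.log n)) ^ n := by
  have hn2 : (2 : ℝ) ≤ n := by exact_mod_cast hn
  have hl : 2 / 3 ≤ Real.log n := by
    have := Real.log_le_log two_pos hn2
    linarith [Real.log_two_gt_d9]
  have h1 := one_sub_cdf_gaussianReal_le_exp_neg hl (s := v - Real.log (Real.log n) / 2)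
    (by linarith)
  rw [Real.exp_neg, Real.exp_log (by linarith)] at h1
  set q := cdf (gaussianReal 0 1)
    (√(2 * Real.log n) + (v - Real.log (Real.log n) / 2) / √(2 * Real.log n))
  have hq := cdf_nonneg (gaussianReal 0 1)
    (√(2 * Real.log n) + (v - Real.log (Real.log n) / 2) / √(2 * Real.log n))
  have h2 := one_add_mul_le_pow (a := q - 1) (by linarith) n
  have h3 := mul_le_mul_of_nonneg_left h1 (by linarith : (0 : ℝ) ≤ n)
  have h4 : (n : ℝ) * ((n : ℝ)⁻¹ / 2) = 1 / 2 := by field_simp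
  rw [add_sub_cancel] at h2
  linarith

/-! ### Rescaling and two-sided bounds for the one-dimensional integral -/

theorem integral_gaussianReal_eq_rescaled {κ δ l : ℝ} (hκ : 0 < κ) (hl : 0 < l) (h : ℝ → ℝ) :
    ∫ w, h (δ * √(2 * l) + w) ∂(gaussianReal 0 κ.toNNReal) =
      Real.exp (-l) ^ ((1 - δ) ^ 2 / κ) * l ^ (((1 - δ) / κ - 1) / 2) * (2 * √(Real.pi * κ))⁻¹ *
        ∫ v, h (√(2 * l) + (v - Real.log l / 2) / √(2 * l)) * Real.exp (-((1 - δ) / κ * v)) *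
          Real.exp (-((v - Real.log l / 2) ^ 2 / (4 * κ * l))) := by
  set L := √(2 * l) with hL
  have hLp : 0 < L := Real.sqrt_pos.2 (by linarith)
  have hL2 : L ^ 2 = 2 * l := Real.sq_sqrt (by linarith)
  -- The substitution is `w = v / L + m`, a translation by `m` followed by a dilation by `L`.
  set m := (1 - δ) * L - Real.log l / 2 / L with hm
  rw [integral_gaussianReal_eq_integral_smul (by simpa using hκ)]
  rw [← integral_add_right_eq_self _ m]
  have h1 := Measure.integral_comp_div (fun w => gaussianPDFReal 0 κ.toNNReal (w + m) •
    h (δ * L + (w + m))) L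
  rw [abs_of_pos hLp, smul_eq_mul] at h1
  have h2 : ∀ I J : ℝ, J = L * I → I = L⁻¹ * J := by
    intro I J h; rw [h]; field_simp
  rw [h2 _ _ h1, ← integral_const_mul, ← integral_const_mul]
  refine integral_congr_ae (ae_of_all _ fun v => ?_)
  simp only [smul_eq_mul]
  have e1 : δ * L + (v / L + m) = L + (v - Real.log l / 2) / L := by rw [hm]; ring
  rw [e1, gaussianPDFReal, Real.coe_toNNReal _ hκ.le, sub_zero]
  have e2 : -(v / L + m) ^ 2 / (2 * κ) = -l * ((1 - δ) ^ 2 / κ) + Real.log l * ((1 - δ) / κ / 2)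
      + -((1 - δ) / κ * v) + -((v - Real.log l / 2) ^ 2 / (4 * κ * l)) := by
    have e3 : v / L + m = (1 - δ) * L + (v - Real.log l / 2) / L := by rw [hm]; ring
    rw [e3, add_sq, mul_pow, div_pow, hL2]
    field_simp
    ring
  rw [e2, Real.exp_add, Real.exp_add, Real.exp_add, ← Real.exp_mul, sub_div _ 1 2, Real.rpow_sub hl,
    ← Real.sqrt_eq_rpow, Real.rpow_def_of_pos hl ((1 - δ) / κ / 2), hL,
    show 2 * Real.pi * κ = 2 * (Real.pi * κ) by ring, Real.sqrt_mul zero_le_two,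
    Real.sqrt_mul zero_le_two]
  have e4 : √2 * √2 = 2 := Real.mul_self_sqrt zero_le_two
  have e5 : 0 < √l := Real.sqrt_pos.2 hl
  have e6 : 0 < √(Real.pi * κ) := Real.sqrt_pos.2 (by positivity)
  have e7 : (√2 * √l)⁻¹ * (√2 * √(Real.pi * κ))⁻¹ = (2 * √(Real.pi * κ))⁻¹ / √l := by
    rw [← mul_inv, show √2 * √l * (√2 * √(Real.pi * κ)) = √2 * √2 * √l * √(Real.pi * κ) by ring, e4]
    field_simp
  calc _ = ((√2 * √l)⁻¹ * (√2 * √(Real.pi * κ))⁻¹) * (Real.exp (-l * ((1 - δ) ^ 2 / κ)) *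
          Real.exp (Real.log l * ((1 - δ) / κ / 2)) * Real.exp (-((1 - δ) / κ * v)) *
          Real.exp (-((v - Real.log l / 2) ^ 2 / (4 * κ * l))) *
          h (√2 * √l + (v - Real.log l / 2) / (√2 * √l))) := by ring
    _ = _ := by rw [e7]; ring

theorem exists_exp_neg_mul_le_rpow_mul_log {c : ℝ} (hc : 0 < c) (α : ℝ) {β : ℝ} (hβ : 0 < β) :
    ∃ C : ℝ, 0 < C ∧ ∀ n : ℕ, 2 ≤ n →
      Real.exp (-(n * c)) ≤ C * ((n : ℝ) ^ (-α) * Real.log n ^ ((β - 1) / 2)) := by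
  -- The extra `1 / 2` pays for the possibly negative power of the logarithm, through `log n ≤ n`.
  obtain ⟨k, hk⟩ := exists_nat_ge (α + 1 / 2)
  have hl2 : 0 < Real.log 2 := Real.log_pos one_lt_two
  refine ⟨k.factorial * c⁻¹ ^ k * (Real.log 2 ^ (β / 2))⁻¹, by positivity, fun n hn => ?_⟩
  have hn2 : (2 : ℝ) ≤ n := by exact_mod_cast hn
  have hn0 : (0 : ℝ) < n := by linarith
  have hlog : Real.log 2 ≤ Real.log n := Real.log_le_log two_pos hn2
  have hl0 : 0 < Real.log n := hl2.trans_le hlog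
  have h1 := Real.pow_div_factorial_le_exp (x := (n : ℝ) * c) (by positivity) k
  have h2 : (n : ℝ) ^ (α + 1 / 2) ≤ (n : ℝ) ^ k := by
    rw [← Real.rpow_natCast]
    exact Real.rpow_le_rpow_of_exponent_le (by linarith) hk
  have h3 : Real.exp (-((n : ℝ) * c)) ≤ k.factorial * c⁻¹ ^ k * (n : ℝ) ^ (-(α + 1 / 2)) := by
    rw [Real.exp_neg, Real.rpow_neg hn0.le]
    calc _ ≤ ((n * c : ℝ) ^ k / k.factorial)⁻¹ := by gcongr
      _ = k.factorial * c⁻¹ ^ k * ((n : ℝ) ^ k)⁻¹ := by rw [mul_pow, inv_pow]; field_simp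
      _ ≤ _ := by gcongr
  have h4 : Real.log 2 ^ (β / 2) * (n : ℝ) ^ (-(1 / 2) : ℝ) ≤ Real.log n ^ ((β - 1) / 2) := by
    rw [sub_div, sub_eq_add_neg, Real.rpow_add hl0]
    refine mul_le_mul (Real.rpow_le_rpow hl2.le hlog (by positivity)) ?_ (by positivity)
      (by positivity)
    exact Real.rpow_le_rpow_of_nonpos hl0 (Real.log_le_self hn0.le) (by norm_num)
  refine h3.trans ?_
  rw [neg_add, Real.rpow_add hn0]
  calc _ = k.factorial * c⁻¹ ^ k * (Real.log 2 ^ (β / 2))⁻¹ *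
        ((n : ℝ) ^ (-α) * (Real.log 2 ^ (β / 2) * (n : ℝ) ^ (-(1 / 2) : ℝ))) := by
        have : 0 < Real.log 2 ^ (β / 2) := by positivity
        field_simp
    _ ≤ _ := by gcongr

theorem measurable_cdf_gaussianReal_pow (n : ℕ) :
    Measurable fun u => cdf (gaussianReal 0 1) u ^ n :=
  (monotone_cdf _).measurable.pow_const n

theorem integrable_exp_neg_mul_abs {b : ℝ} (hb : 0 < b) :
    Integrable fun v : ℝ => Real.exp (-(b * |v|)) := by
  -- A non-integrable function has integral `0` by convention, whereas the formula for even
  -- functions gives `2 / b > 0`.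
  by_contra h
  have h1 := integral_comp_abs (f := fun v => Real.exp (-b * v))
  rw [integral_exp_mul_Ioi (by linarith)] at h1
  simp only [neg_mul] at h1
  rw [integral_undef h] at h1
  simp only [mul_zero, neg_zero, Real.exp_zero] at h1
  have : 0 < 2 * (-1 / -b) := by rw [neg_div_neg_eq]; positivity
  linarith

theorem exists_integral_pow_cdf_le {κ δ : ℝ} (hκ : 0 < κ) (hδ : δ < 1) :
    ∃ C : ℝ, 0 < C ∧ ∀ n : ℕ, 2 ≤ n →
      ∫ w, cdf (gaussianReal 0 1) (δ * √(2 * Real.log n) + w) ^ n ∂(gaussianReal 0 κ.toNNReal) ≤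
        C * ((n : ℝ) ^ (-((1 - δ) ^ 2 / κ)) * Real.log n ^ (((1 - δ) / κ - 1) / 2)) := by
  set β := (1 - δ) / κ with hβ
  have hβ0 : 0 < β := div_pos (by linarith) hκ
  set b := min β 1
  have hb : 0 < b := lt_min hβ0 one_pos
  obtain ⟨C₁, hC₁, h₁⟩ := exists_pow_cdf_le (β := β)
  obtain ⟨C₂, hC₂, h₂⟩ := exists_exp_neg_mul_le_rpow_mul_log (c := Real.exp (-3 / 2) / 3)
    (by positivity) ((1 - δ) ^ 2 / κ) hβ0
  set I := ∫ v : ℝ, Real.exp (-(b * |v|)) with hI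
  have hI0 : 0 ≤ I := integral_nonneg fun _ => (Real.exp_pos _).le
  refine ⟨(2 * √(Real.pi * κ))⁻¹ * (C₁ * I) + C₂, by positivity, fun n hn => ?_⟩
  have hn2 : (2 : ℝ) ≤ n := by exact_mod_cast hn
  have hn0 : (0 : ℝ) < n := by linarith
  have hl : 0 < Real.log n := Real.log_pos (by linarith)
  -- The majorant needs `u ≥ 0`. For `u < 0` the tail is at least its lower bound at `0`, so the
  -- power is exponentially small in `n` and goes into `C₂`.
  set h : ℝ → ℝ := (Set.Ici 0).indicator fun u => cdf (gaussianReal 0 1) u ^ n with hh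
  have hhm : Measurable h := (measurable_cdf_gaussianReal_pow n).indicator measurableSet_Ici
  have hh0 : ∀ u, 0 ≤ h u := fun u => Set.indicator_nonneg (fun _ _ => pow_nonneg (cdf_nonneg _ _) _) u
  have hh1 : ∀ u, h u ≤ 1 := fun u => Set.indicator_apply_le' (fun _ => pow_le_one₀ (cdf_nonneg _ _)
    (cdf_le_one _ _)) fun _ => zero_le_one
  have hle : ∀ u, cdf (gaussianReal 0 1) u ^ n ≤ h u + Real.exp (-(n * (Real.exp (-3 / 2) / 3))) := by
    intro u
    rcases le_or_gt 0 u with hu | hu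
    · rw [hh, Set.indicator_of_mem (by exact hu)]
      linarith [Real.exp_pos (-(n * (Real.exp (-3 / 2) / 3)))]
    · rw [hh, Set.indicator_of_notMem (by simpa using hu), zero_add]
      refine (pow_cdf_gaussianReal_le n u).trans (Real.exp_le_exp.2 (neg_le_neg ?_))
      refine mul_le_mul_of_nonneg_left ?_ hn0.le
      have h0 := le_one_sub_cdf_gaussianReal le_rfl
      have h3 := monotone_cdf (gaussianReal 0 1) hu.le
      norm_num at h0
      have e : (-3 / 2 : ℝ) = -(3 / 2) := by norm_num
      rw [e]
      linarith
  have hexp : Real.exp (-Real.log n) ^ ((1 - δ) ^ 2 / κ) = (n : ℝ) ^ (-((1 - δ) ^ 2 / κ)) := by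
    rw [Real.exp_neg, Real.exp_log hn0, Real.rpow_neg hn0.le, Real.inv_rpow hn0.le]
  set A := (n : ℝ) ^ (-((1 - δ) ^ 2 / κ)) * Real.log n ^ ((β - 1) / 2) with hA
  have hA0 : 0 ≤ A := by positivity
  have hint : Integrable (fun w => h (δ * √(2 * Real.log n) + w)) (gaussianReal 0 κ.toNNReal) :=
    Integrable.of_bound (C := 1) (hhm.comp (by fun_prop)).aestronglyMeasurable
      (ae_of_all _ fun w => by rw [Real.norm_eq_abs, abs_of_nonneg (hh0 _)]; exact hh1 _)
  calc ∫ w, cdf (gaussianReal 0 1) (δ * √(2 * Real.log n) + w) ^ n ∂(gaussianReal 0 κ.toNNReal)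
      ≤ ∫ w, (h (δ * √(2 * Real.log n) + w) + Real.exp (-(n * (Real.exp (-3 / 2) / 3))))
          ∂(gaussianReal 0 κ.toNNReal) := by
        refine integral_mono_of_nonneg (ae_of_all _ fun w => pow_nonneg (cdf_nonneg _ _) _)
          (hint.add (integrable_const _)) (ae_of_all _ fun w => hle _)
    _ = ∫ w, h (δ * √(2 * Real.log n) + w) ∂(gaussianReal 0 κ.toNNReal) +
          Real.exp (-(n * (Real.exp (-3 / 2) / 3))) := by
        rw [integral_add hint (integrable_const _)]; simp
    _ ≤ A * (2 * √(Real.pi * κ))⁻¹ * (C₁ * I) + C₂ * A := by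
        refine add_le_add ?_ (h₂ n hn)
        rw [integral_gaussianReal_eq_rescaled hκ hl, hexp, ← hβ, ← hA]
        gcongr
        rw [hI, ← integral_const_mul]
        refine integral_mono_of_nonneg (ae_of_all _ fun v => ?_)
          ((integrable_exp_neg_mul_abs hb).const_mul C₁) (ae_of_all _ fun v => ?_)
        · exact mul_nonneg (mul_nonneg (hh0 _) (Real.exp_pos _).le) (Real.exp_pos _).le
        · have e1 : Real.exp (-((v - Real.log (Real.log n) / 2) ^ 2 / (4 * κ * Real.log n))) ≤ 1 := by
            rw [Real.exp_le_one_iff]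
            have : 0 ≤ (v - Real.log (Real.log n) / 2) ^ 2 / (4 * κ * Real.log n) := by positivity
            linarith
          refine (mul_le_of_le_one_right (mul_nonneg (hh0 _) (Real.exp_pos _).le) e1).trans ?_
          rcases le_or_gt 0 (√(2 * Real.log n) +
            (v - Real.log (Real.log n) / 2) / √(2 * Real.log n)) with hu | hu
          · rw [hh, Set.indicator_of_mem (by exact hu)]
            exact h₁ n v hn hu
          · rw [hh, Set.indicator_of_notMem (by simpa using hu), zero_mul]
            positivity
    _ = _ := by ring

theorem exists_le_integral_pow_cdf {κ δ : ℝ} (hκ : 0 < κ) (hδ : δ < 1) :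
    ∃ c : ℝ, 0 < c ∧ ∀ n : ℕ, 2 ≤ n →
      c * ((n : ℝ) ^ (-((1 - δ) ^ 2 / κ)) * Real.log n ^ (((1 - δ) / κ - 1) / 2)) ≤
      ∫ w, cdf (gaussianReal 0 1) (δ * √(2 * Real.log n) + w) ^ n ∂(gaussianReal 0 κ.toNNReal) := by
  set β := (1 - δ) / κ with hβ
  have hβ0 : 0 < β := div_pos (by linarith) hκ
  -- Only `0 ≤ v ≤ 1` is kept. There the power is at least `1 / 2`, `exp (-β v) ≥ exp (-β)`, and `(v
  -- - log (log n) / 2)² ≤ 5 log n` bounds the quadratic correction.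
  refine ⟨(2 * √(Real.pi * κ))⁻¹ * (1 / 2 * Real.exp (-β) * Real.exp (-(5 / (4 * κ)))),
    by positivity, fun n hn => ?_⟩
  have hn2 : (2 : ℝ) ≤ n := by exact_mod_cast hn
  have hn0 : (0 : ℝ) < n := by linarith
  have hl23 : 2 / 3 ≤ Real.log n := by
    have := Real.log_le_log two_pos hn2
    linarith [Real.log_two_gt_d9]
  have hl : 0 < Real.log n := by linarith
  have hexp : Real.exp (-Real.log n) ^ ((1 - δ) ^ 2 / κ) = (n : ℝ) ^ (-((1 - δ) ^ 2 / κ)) := by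
    rw [Real.exp_neg, Real.exp_log hn0, Real.rpow_neg hn0.le, Real.inv_rpow hn0.le]
  set A := (n : ℝ) ^ (-((1 - δ) ^ 2 / κ)) * Real.log n ^ ((β - 1) / 2) with hA
  have hA0 : 0 ≤ A := by positivity
  set L := √(2 * Real.log n) with hL
  have hLp : 0 < L := Real.sqrt_pos.2 (by linarith)
  set a := Real.log (Real.log n) / 2 with ha
  set S : Set ℝ := Set.Icc (L + (0 - a) / L) (L + (1 - a) / L) with hS
  set h : ℝ → ℝ := S.indicator fun _ => 1 / 2 with hh
  have hmem : ∀ v, L + (v - a) / L ∈ S ↔ v ∈ Set.Icc 0 1 := by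
    intro v
    rw [hS, Set.mem_Icc, Set.mem_Icc, add_le_add_iff_left, add_le_add_iff_left,
      div_le_div_iff_of_pos_right hLp, div_le_div_iff_of_pos_right hLp, sub_le_sub_iff_right,
      sub_le_sub_iff_right]
  have hhm : Measurable h := measurable_const.indicator measurableSet_Icc
  have hle : ∀ u, h u ≤ cdf (gaussianReal 0 1) u ^ n := by
    refine fun u => Set.indicator_apply_le' (fun hu => ?_) fun _ => pow_nonneg (cdf_nonneg _ _) _
    have hu' : u = L + (L * (u - L) + a - a) / L := by field_simp; ring
    rw [hu'] at hu ⊢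
    exact half_le_pow_cdf hn ((hmem _).1 hu).1
  have hint : ∀ f : ℝ → ℝ, Measurable f → (∀ u, 0 ≤ f u) → (∀ u, f u ≤ 1) →
      Integrable (fun w => f (δ * L + w)) (gaussianReal 0 κ.toNNReal) := fun f hf h0 h1 =>
    Integrable.of_bound (C := 1) (hf.comp (by fun_prop)).aestronglyMeasurable
      (ae_of_all _ fun w => by rw [Real.norm_eq_abs, abs_of_nonneg (h0 _)]; exact h1 _)
  have hpow1 : ∀ u, cdf (gaussianReal 0 1) u ^ n ≤ 1 :=
    fun u => pow_le_one₀ (cdf_nonneg _ _) (cdf_le_one _ _)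
  have hmono : ∫ w, h (δ * L + w) ∂(gaussianReal 0 κ.toNNReal) ≤
      ∫ w, cdf (gaussianReal 0 1) (δ * L + w) ^ n ∂(gaussianReal 0 κ.toNNReal) :=
    integral_mono (hint h hhm (fun u => Set.indicator_nonneg (fun _ _ => by norm_num) u)
      fun u => (hle u).trans (hpow1 u))
      (hint _ (measurable_cdf_gaussianReal_pow n) (fun u => pow_nonneg (cdf_nonneg _ _) _) hpow1)
      fun w => hle _
  refine le_trans ?_ hmono
  rw [integral_gaussianReal_eq_rescaled hκ hl h, hexp, ← hβ, ← hA, mul_comm _ A, ← mul_assoc]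
  refine mul_le_mul_of_nonneg_left ?_ (by positivity)
  set G : ℝ → ℝ := fun v => 1 / 2 * Real.exp (-(β * v)) *
      Real.exp (-((v - a) ^ 2 / (4 * κ * Real.log n))) with hG
  have hGc : Continuous G := by fun_prop
  have hGeq : (fun v => h (L + (v - a) / L) * Real.exp (-(β * v)) *
      Real.exp (-((v - a) ^ 2 / (4 * κ * Real.log n)))) = (Set.Icc 0 1).indicator G := by
    ext v
    by_cases hv : v ∈ Set.Icc (0 : ℝ) 1
    · rw [Set.indicator_of_mem hv, hh, Set.indicator_of_mem ((hmem v).2 hv)]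
    · rw [Set.indicator_of_notMem hv, hh, Set.indicator_of_notMem (mt (hmem v).1 hv)]
      simp
  rw [hGeq, integral_indicator measurableSet_Icc]
  have hconst : 1 / 2 * Real.exp (-β) * Real.exp (-(5 / (4 * κ))) =
      ∫ _ in Set.Icc (0 : ℝ) 1, 1 / 2 * Real.exp (-β) * Real.exp (-(5 / (4 * κ))) := by simp
  rw [hconst]
  refine setIntegral_mono_on (integrableOn_const (by simp)) hGc.integrableOn_Icc
    measurableSet_Icc fun v hv => ?_
  simp only [hG]
  gcongr 1 / 2 * Real.exp ?_ * Real.exp ?_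
  · nlinarith [hv.2]
  · refine neg_le_neg ?_
    rw [div_le_div_iff₀ (by positivity) (by positivity)]
    have hs2 : √(Real.log n) ^ 2 = Real.log n := Real.sq_sqrt hl.le
    have hlog2 := abs_le.1 (abs_log_le_two_mul_sqrt hl23)
    have e1 : a ^ 2 ≤ Real.log n := by
      rw [← hs2]
      exact sq_le_sq' (by linarith [hlog2.1]) (by linarith [hlog2.2])
    have e2 : v ^ 2 ≤ 1 := pow_le_one₀ hv.1 hv.2
    have e3 : (v - a) ^ 2 ≤ 5 * Real.log n := by nlinarith [sq_nonneg (v + a)]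
    calc (v - a) ^ 2 * (4 * κ) ≤ 5 * Real.log n * (4 * κ) := by gcongr
      _ = _ := by ring

theorem theorem2p2 (δ₀ ρ₀ α₀ β₀ : ℝ)
    (hδ₀ : δ₀ ∈ Set.Ioo (0 : ℝ) 1) (hρ₀ : ρ₀ ∈ Set.Ioo (0 : ℝ) 1)
    (hα₀ : α₀ = (1 - ρ₀) * (1 - δ₀) ^ 2 / ρ₀)
    (hβ₀ : β₀ = (1 - ρ₀) * (1 - δ₀) / ρ₀) :
    (∃ C : ℝ, 0 < C ∧
      ∀ (n : ℕ), 2 ≤ n →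
      ∀ (Ω : Type u) [MeasurableSpace Ω] (P : Measure Ω) [IsProbabilityMeasure P]
        (X : Fin n → Ω → ℝ),
        IsStandardizedGaussianVector X P →
        (∀ i j, i ≠ j → correlationMatrix X P i j ≤ ρ₀) →
        P.real {ω | (⨆ i, X i ω) ≤ δ₀ * √(2 * (1 - ρ₀) * Real.log n)}
          ≤ C * (n : ℝ) ^ (-α₀) * Real.log n ^ ((β₀ - 1) / 2)) ∧
    (∃ c : ℝ, 0 < c ∧
      ∀ (n : ℕ), 2 ≤ n →
      ∀ (Ω : Type u) [MeasurableSpace Ω] (P : Measure Ω) [IsProbabilityMeasure P]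
        (X : Fin n → Ω → ℝ),
        IsStandardizedGaussianVector X P →
        (∀ i j, i ≠ j → correlationMatrix X P i j = ρ₀) →
        c * (n : ℝ) ^ (-α₀) * Real.log n ^ ((β₀ - 1) / 2)
          ≤ P.real {ω | (⨆ i, X i ω) ≤ δ₀ * √(2 * (1 - ρ₀) * Real.log n)}) := by
  have h1 : 0 < 1 - ρ₀ := by linarith [hρ₀.2]
  have hκ : 0 < ρ₀ / (1 - ρ₀) := div_pos hρ₀.1 h1
  have hα : (1 - δ₀) ^ 2 / (ρ₀ / (1 - ρ₀)) = α₀ := by rw [hα₀, div_div_eq_mul_div]; ring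
  have hβ : (1 - δ₀) / (ρ₀ / (1 - ρ₀)) = β₀ := by rw [hβ₀, div_div_eq_mul_div]; ring
  -- Factoring out `√(1 - ρ₀)` matches the scaling of the equicorrelated representation.
  have ht : ∀ n : ℕ, δ₀ * √(2 * (1 - ρ₀) * Real.log n) =
      √(1 - ρ₀) * (δ₀ * √(2 * Real.log n)) := fun n => by
    rw [show 2 * (1 - ρ₀) * Real.log n = (1 - ρ₀) * (2 * Real.log n) by ring,
      Real.sqrt_mul h1.le]
    ring
  obtain ⟨C, hC, hupper⟩ := exists_integral_pow_cdf_le hκ hδ₀.2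
  obtain ⟨c, hc, hlower⟩ := exists_le_integral_pow_cdf hκ hδ₀.2
  rw [hα, hβ] at hupper hlower
  refine ⟨⟨C, hC, fun n hn Ω _ P _ X hX hR => ?_⟩, ⟨c, hc, fun n hn Ω _ P _ X hX hR => ?_⟩⟩
  · have : Nonempty (Fin n) := ⟨⟨0, by omega⟩⟩
    have h := hX.measureReal_iSup_le_le hρ₀ hR (δ₀ * √(2 * Real.log n))
    rw [Fintype.card_fin] at h
    rw [ht, mul_assoc C]
    exact h.trans (hupper n hn)
  · have : Nonempty (Fin n) := ⟨⟨0, by omega⟩⟩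
    have h := hX.le_measureReal_iSup_le hρ₀ (fun i j hij => (hR i j hij).ge)
      (δ₀ * √(2 * Real.log n))
    rw [Fintype.card_fin] at h
    rw [ht, mul_assoc c]
    exact (hlower n hn).trans h
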